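/- Let $G=\langle g\rangle$ be an infinite cyclic group. A Brauer $G$-set $E=(E,U,\tau,d)$ consists of a $G$-set $E$ (whose elements are called half-edges), a subset $U\subseteq E$, an involution $\tau:U\to U$ (possibly with fixed points), and a function $d:E\to\mathbb{Z}_{>0}$ that is constant on $G$-orbits, such that, with $\sigma(e)=g^{d(e)}\cdot e$, one has $\sigma(U)=U$ and $\tau\sigma(e)=\sigma\tau(e)$ for all $e\in U$. Its vertices are the $G$-orbits in $E$, its double half-edges are the elements $e\in U$ with $\tau(e)=e$, and its edges are the sets $\{e,\tau(e)\}$ with $e\in U$, $\tau(e)\ne e$. The f-degree of a finite vertex $v$ is $d(v)/|v|$, where $d(v)$ is the value of $d$ on $v$; $E$ is of integral f-degree if all its vertices are finite with integral f-degree. A walk from $e_0$ to $e_m$ is a sequence $e_m\overset{\delta_m}{-}e_{m-1}\cdots e_1\overset{\delta_1}{-}e_0$ with $m\ge 0$, $\delta_i\in\{g,g^{-1},\tau\}$ and $e_i=\delta_i(e_{i-1})$, where $e_{i-1}\in U$ is required if $\delta_i=\tau$. $E$ is connected if any two half-edges are joined by a walk. Homotopy $\approx$ is the equivalence relation on walks,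 compatible with composition on both sides, generated by $g^{-1}g\approx gg^{-1}\approx$ the trivial walk at every $e\in E$, $\tau\tau\approx$ the trivial walk at every $e\in U$, and $\tau g^{d(e)}\approx g^{d(\tau(e))}\tau$ as walks from $e$ to $\tau\sigma(e)=\sigma\tau(e)$, for every $e\in U$. The fundamental group $\Pi_m(E,e)$ is the group of homotopy classes of closed walks at $e$, with product induced by composition of walks. Let $E$ be a finite connected Brauer $G$-set of integral f-degree with $n$ vertices $v_1,\dots,v_n$, $k$ edges and $l$ double half-edges, let $d_i$ be the f-degree of $v_i$, and let $e\in E$. Then $r=k-n+1$ is non-negative, and $\Pi_m(E,e)$ is isomorphic to the group with generators $a_1,\dots,a_n,b_1,\dots,b_r,c_1,\dots,c_l$ and relations $$a_1^{d_1}=\cdots=a_n^{d_n},\qquad a_1^{d_1}b_i=b_ia_1^{d_1}\ (1\le i\le r),\qquad a_1^{d_1}c_j=c_ja_1^{d_1},\quad c_j^2=1\ (1\le j\le l).$$ -/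

import Mathlib

/-- The fixed generator `g` of the infinite cyclic group `G`, here `Multiplicative ℤ`. -/
abbrev genG : Multiplicative ℤ := Multiplicative.ofAdd 1

/-- A Brauer `G`-set `(E, U, τ, d)` on the `G`-set `E`, where `G` is infinite cyclic. -/
structure BrauerGSet (E : Type*) [MulAction (Multiplicative ℤ) E] where
  /-- the distinguished set of half-edges on which the involution is defined -/
  U : Set E
  /-- the involution on `U`; fixed points are allowed -/
  τ : U → U
  τ_involutive : Function.Involutive τ
  /-- the degree function -/
  d : E → ℕ
  d_pos : ∀ e, 0 < d e
  d_orbit : ∀ e₁ e₂ : E, e₁ ∈ MulAction.orbit (Multiplicative ℤ) e₂ → d e₁ = d e₂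
  /-- `σ(U) = U` for `σ(e) = g ^ d(e) • e` -/
  image_σ : (fun e : E => genG ^ d e • e) '' U = U
  /-- `τ(σ(e)) = σ(τ(e))` for `e ∈ U` -/
  τ_σ : ∀ (e : U) (h : genG ^ d (e : E) • (e : E) ∈ U),
    (τ ⟨genG ^ d (e : E) • (e : E), h⟩ : E) = genG ^ d (τ e : E) • (τ e : E)

namespace BrauerGSet

/-- The three possible letters of a walk. -/
inductive Letter : Type
  | g : Letter
  | gInv : Letter
  | tau : Letter

variable {E : Type*} [MulAction (Multiplicative ℤ) E] (B : BrauerGSet E)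

/-- The Nakayama automorphism. -/
abbrev σ (e : E) : E := genG ^ B.d e • e

/-- The vertices are the `G`-orbits of half-edges. -/
abbrev Vertex (_B : BrauerGSet E) : Type _ := MulAction.orbitRel.Quotient (Multiplicative ℤ) E

/-- The value of the degree function on a vertex. -/
def vertexDegree : B.Vertex → ℕ :=
  Quotient.lift B.d fun a b h => B.d_orbit a b h

/-- The f-degree `d(v) / |v|` of a (finite) vertex `v`. -/
noncomputable def fDegree (v : B.Vertex) : ℚ := (B.vertexDegree v : ℚ) / (v.orbit.ncard : ℚ)

/-- All vertices are finite and all their f-degrees are integers. -/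
def IntegralFDegree : Prop :=
  ∀ v : B.Vertex, v.orbit.Finite ∧ ∃ m : ℤ, B.fDegree v = m

/-- The set of edges `{e, τ(e)}`, where `e ∈ U` and `τ(e) ≠ e`. -/
def edges : Set (Set E) := {s | ∃ e : B.U, B.τ e ≠ e ∧ s = {(e : E), (B.τ e : E)}}

/-- The set of double half-edges, the `e ∈ U` with `τ(e) = e`. -/
def doubleHalfEdges : Set E := {x | ∃ e : B.U, B.τ e = e ∧ (e : E) = x}

/-- `B.IsStep δ a b` says that the letter `δ` can be read at `a`, and leads to `b`. -/
def IsStep : Letter → E → E → Prop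
  | .g, a, b => b = genG • a
  | .gInv, a, b => b = genG⁻¹ • a
  | .tau, a, b => ∃ h : a ∈ B.U, b = B.τ ⟨a, h⟩

/-- `B.Walk a b` is the type of walks with source `a` and terminal `b`.  The letter added by
`cons` is the last one that is traversed; it is written on the left. -/
inductive Walk (a : E) : E → Type _
  | nil : Walk a a
  | cons {b c : E} (δ : Letter) (h : B.IsStep δ b c) (w : Walk a b) : Walk a c

/-- Any two half-edges can be connected by a walk. -/
def Connected : Prop := ∀ e₁ e₂ : E, Nonempty (B.Walk e₁ e₂)

variable {B}

/-- The composition `u v` of walks: first `v`, then `u`. -/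
def Walk.comp {a b c : E} : B.Walk b c → B.Walk a b → B.Walk a c
  | .nil, v => v
  | .cons δ h u, v => .cons δ h (Walk.comp u v)

/-- The walk of length one with the letter `δ`. -/
def Walk.single {a b : E} (δ : Letter) (h : B.IsStep δ a b) : B.Walk a b := .cons δ h .nil

variable (B)

/-- The walk `(g ^ n • e | g ^ n | e)`, in which the letter `g` is read `n` times. -/
def gWalk (e : E) : (n : ℕ) → B.Walk e (genG ^ n • e)
  | 0 => (one_smul (Multiplicative ℤ) e).symm ▸ Walk.nil
  | n + 1 => .cons .g (show genG ^ (n + 1) • e = genG • genG ^ n • e by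
      rw [pow_succ', mul_smul]) (gWalk e n)

theorem σ_mem (e : B.U) : B.σ (e : E) ∈ B.U := by
  have h := B.image_σ
  exact h.subset ⟨e, e.2, rfl⟩

theorem isStep_tau (e : B.U) : B.IsStep .tau (e : E) (B.τ e : E) := ⟨e.2, rfl⟩

theorem isStep_tau_σ (e : B.U) : B.IsStep .tau (B.σ (e : E)) (B.σ (B.τ e : E)) :=
  ⟨B.σ_mem e, (B.τ_σ e (B.σ_mem e)).symm⟩

/-- The homotopy relation: the equivalence relation on walks that is generated by the relations
below. Homotopic walks have the same source and the same terminal. -/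
inductive Homotopic : {a b : E} → B.Walk a b → B.Walk a b → Prop
  | refl {a b : E} (w : B.Walk a b) : Homotopic w w
  | symm {a b : E} {w₁ w₂ : B.Walk a b} : Homotopic w₁ w₂ → Homotopic w₂ w₁
  | trans {a b : E} {w₁ w₂ w₃ : B.Walk a b} :
      Homotopic w₁ w₂ → Homotopic w₂ w₃ → Homotopic w₁ w₃
  /-- `(e | g⁻¹ g | e) ≈ (e || e)` -/
  | gInv_g {e x : E} (h₁ : B.IsStep .g e x) (h₂ : B.IsStep .gInv x e) :
      Homotopic ((Walk.single .gInv h₂).comp (Walk.single .g h₁)) Walk.nil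
  /-- `(e | g g⁻¹ | e) ≈ (e || e)` -/
  | g_gInv {e x : E} (h₁ : B.IsStep .gInv e x) (h₂ : B.IsStep .g x e) :
      Homotopic ((Walk.single .g h₂).comp (Walk.single .gInv h₁)) Walk.nil
  /-- `(e | τ τ | e) ≈ (e || e)` -/
  | tau_tau {e x : E} (h₁ : B.IsStep .tau e x) (h₂ : B.IsStep .tau x e) :
      Homotopic ((Walk.single .tau h₂).comp (Walk.single .tau h₁)) Walk.nil
  /-- `τ g ^ d(e) ≈ g ^ d(τ(e)) τ` as walks from `e` to `τ(σ(e)) = σ(τ(e))` -/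
  | tau_gPow (e : B.U) :
      Homotopic
        ((Walk.single .tau (B.isStep_tau_σ e)).comp (B.gWalk (e : E) (B.d (e : E))))
        ((B.gWalk (B.τ e : E) (B.d (B.τ e : E))).comp (Walk.single .tau (B.isStep_tau e)))
  | comp_left {a b c : E} (u : B.Walk b c) {w₁ w₂ : B.Walk a b} :
      Homotopic w₁ w₂ → Homotopic (u.comp w₁) (u.comp w₂)
  | comp_right {a b c : E} {w₁ w₂ : B.Walk b c} (v : B.Walk a b) :
      Homotopic w₁ w₂ → Homotopic (w₁.comp v) (w₂.comp v)

variable {B}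

theorem Walk.comp_nil {a b : E} (w : B.Walk a b) : w.comp .nil = w := by
  induction w with
  | nil => rfl
  | cons δ h w ih => simp [Walk.comp, ih]

theorem Walk.comp_assoc {a b c d : E} (u : B.Walk c d) (v : B.Walk b c) (w : B.Walk a b) :
    (u.comp v).comp w = u.comp (v.comp w) := by
  induction u with
  | nil => rfl
  | cons δ h u ih => simp [Walk.comp, ih]

/-- The inverse letter. -/
def Letter.inv : Letter → Letter
  | .g => .gInv
  | .gInv => .g
  | .tau => .tau

theorem IsStep.inv {δ : Letter} {a b : E} (h : B.IsStep δ a b) : B.IsStep δ.inv b a := by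
  cases δ with
  | g => simp only [IsStep, Letter.inv] at h ⊢; rw [h, inv_smul_smul]
  | gInv => simp only [IsStep, Letter.inv] at h ⊢; rw [h, smul_inv_smul]
  | tau =>
    obtain ⟨ha, rfl⟩ := h
    exact ⟨(B.τ ⟨a, ha⟩).2, by rw [Subtype.coe_eta, B.τ_involutive]⟩

/-- The walk traversed backwards. -/
def Walk.reverse {a b : E} : B.Walk a b → B.Walk b a
  | .nil => .nil
  | .cons _ h w => w.reverse.comp (Walk.single _ h.inv)

theorem homotopic_step_inv {δ : Letter} {a b : E} (h : B.IsStep δ a b) :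
    B.Homotopic ((Walk.single δ.inv h.inv).comp (Walk.single δ h)) .nil := by
  cases δ with
  | g => exact .gInv_g h h.inv
  | gInv => exact .g_gInv h h.inv
  | tau => exact .tau_tau h h.inv

theorem homotopic_inv_step {δ : Letter} {a b : E} (h : B.IsStep δ a b) :
    B.Homotopic ((Walk.single δ h).comp (Walk.single δ.inv h.inv)) .nil := by
  cases δ with
  | g => exact .g_gInv h.inv h
  | gInv => exact .gInv_g h.inv h
  | tau => exact .tau_tau h.inv h

theorem Walk.cons_eq {a b c : E} {δ : Letter} (h : B.IsStep δ b c) (w : B.Walk a b) :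
    Walk.cons δ h w = (Walk.single δ h).comp w := rfl

theorem Walk.reverse_comp_self {a b : E} (w : B.Walk a b) :
    B.Homotopic (w.reverse.comp w) .nil := by
  induction w with
  | nil => exact .refl _
  | cons δ h w ih =>
    rw [Walk.reverse, Walk.cons_eq, Walk.comp_assoc, ← Walk.comp_assoc (Walk.single δ.inv h.inv)]
    exact .trans (.comp_left _ (.comp_right _ (homotopic_step_inv h))) ih

theorem Walk.comp_reverse_self {a b : E} (w : B.Walk a b) :
    B.Homotopic (w.comp w.reverse) .nil := by
  induction w with
  | nil => exact .refl _
  | cons δ h w ih =>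
    rw [Walk.reverse, Walk.cons_eq, Walk.comp_assoc, ← Walk.comp_assoc w]
    exact .trans (.comp_left _ (.comp_right _ ih)) (homotopic_inv_step h)

theorem Homotopic.reverse {a b : E} {w₁ w₂ : B.Walk a b} (h : B.Homotopic w₁ w₂) :
    B.Homotopic w₁.reverse w₂.reverse := by
  have h₁ : B.Homotopic w₁.reverse ((w₁.reverse.comp w₂).comp w₂.reverse) := by
    have := Homotopic.comp_left w₁.reverse w₂.comp_reverse_self
    rw [Walk.comp_nil, ← Walk.comp_assoc] at this
    exact this.symm
  have h₂ : B.Homotopic ((w₁.reverse.comp w₂).comp w₂.reverse)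
      ((w₁.reverse.comp w₁).comp w₂.reverse) :=
    .comp_right _ (.comp_left _ h.symm)
  exact h₁.trans (h₂.trans (.comp_right _ w₁.reverse_comp_self))

variable (B)

/-- Homotopy as a setoid on the walks from `a` to `b`. -/
def walkSetoid (a b : E) : Setoid (B.Walk a b) where
  r := B.Homotopic
  iseqv := ⟨.refl, .symm, .trans⟩

/-- The fundamental group at `e`: homotopy classes of closed walks at `e`. -/
def FundamentalGroup (e : E) : Type _ := Quotient (B.walkSetoid e e)

/-- The product is induced by the composition of walks, `[u] [v] = [u v]`. -/
instance (e : E) : Group (B.FundamentalGroup e) where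
  mul := Quotient.map₂ Walk.comp fun _ _ h₁ _ _ h₂ => (h₁.comp_right _).trans (h₂.comp_left _)
  one := Quotient.mk _ .nil
  inv := Quotient.map Walk.reverse fun _ _ h => h.reverse
  mul_assoc := by
    rintro ⟨u⟩ ⟨v⟩ ⟨w⟩
    exact congrArg (Quotient.mk _) (Walk.comp_assoc u v w)
  one_mul := by
    rintro ⟨u⟩
    rfl
  mul_one := by
    rintro ⟨u⟩
    exact congrArg (Quotient.mk _) u.comp_nil
  inv_mul_cancel := by
    rintro ⟨u⟩
    exact Quotient.sound u.reverse_comp_self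

end BrauerGSet

/-- The generators `a₁, …, aₙ, b₁, …, b_r, c₁, …, c_l`. -/
inductive PresGen (n r l : ℕ) : Type
  | a : Fin n → PresGen n r l
  | b : Fin r → PresGen n r l
  | c : Fin l → PresGen n r l

/-- The relations `a₁ ^ d₁ = ⋯ = aₙ ^ dₙ`, this element commutes with all `bᵢ` and `cⱼ`, and
`cⱼ ^ 2 = 1`; an equation `x = y` is written as the relator `x * y⁻¹`. -/
inductive PresRel {n : ℕ} (d : Fin n → ℕ) (r l : ℕ) : FreeGroup (PresGen n r l) → Prop
  | a_eq (i j : Fin n) : PresRel d r l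
      (FreeGroup.of (.a i) ^ d i * (FreeGroup.of (.a j) ^ d j)⁻¹)
  | ab (t : Fin n) (i : Fin r) : PresRel d r l
      (FreeGroup.of (.a t) ^ d t * FreeGroup.of (.b i) *
        (FreeGroup.of (.b i) * FreeGroup.of (.a t) ^ d t)⁻¹)
  | ac (t : Fin n) (j : Fin l) : PresRel d r l
      (FreeGroup.of (.a t) ^ d t * FreeGroup.of (.c j) *
        (FreeGroup.of (.c j) * FreeGroup.of (.a t) ^ d t)⁻¹)
  | c_sq (j : Fin l) : PresRel d r l (FreeGroup.of (.c j) ^ 2)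

/-- The group presented by these generators and relations. -/
abbrev PresGroup {n : ℕ} (d : Fin n → ℕ) (r l : ℕ) : Type :=
  PresentedGroup {x : FreeGroup (PresGen n r l) | PresRel d r l x}

/-! Integral f-degrees make the size of a vertex `v` divide `d(v)`, so `σ` is the identity and every
`g ^ d(x)` is a loop. The relation between `τ` and `g ^ d` then says that these loops are natural in
`x` (`gPath_d_comm`): transported to `e`, they all become one and the same central element. The
remaining relations only cancel letters.

Choose a spanning tree on the vertices, with a base half-edge at each vertex other than the root
leading towards the root (`exists_rootedTree`), and close up paths along it. A full turn around `v`,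
started at its base, becomes `a_v`, whose power to the f-degree is the central element. A tree edge
becomes trivial, every other edge gives a `b`, and every double half-edge gives a `c` of square one.
This is the map out of the presented group (`presHom`).

For the inverse, label walks in the presented group: `g` gets `a_v` when it arrives at the base of
`v` and 1 otherwise, `τ` gets the generator of its edge. Labels respect homotopy
(`IsTauLabel.isCompatible`) and are 1 on tree paths, so the two homomorphisms are inverse on letters
(`conj_step_g`, `IsTauLabel.map_labelHom`) and on generators. The tree uses `n - 1` edges, which
leaves `k + 1 - n` generators `b` (`ncard_edges_add_one`). -/

namespace BrauerGSet

/-! ### The fundamental groupoid and the central loop. -/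

section Path

variable {E : Type*} [MulAction (Multiplicative ℤ) E] (B : BrauerGSet E)

/-- Homotopy classes of walks from `a` to `b`: the morphisms of the fundamental groupoid. -/
def Path (a b : E) : Type _ := Quotient (B.walkSetoid a b)

variable {B}

/-- The homotopy class of a walk. -/
def Walk.toPath {a b : E} (w : B.Walk a b) : B.Path a b := Quotient.mk (B.walkSetoid a b) w

theorem Homotopic.toPath_eq {a b : E} {u v : B.Walk a b} (h : B.Homotopic u v) :
    u.toPath = v.toPath := Quotient.sound h

theorem isStep_tau_iff {a b : E} :
    B.IsStep .tau a b ↔ ∃ x : B.U, a = x ∧ b = B.τ x :=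
  ⟨fun ⟨h, h'⟩ => ⟨⟨a, h⟩, rfl, h'⟩, by rintro ⟨x, rfl, rfl⟩; exact B.isStep_tau x⟩

namespace Path

/-- The class of the trivial walk. -/
protected def id (a : E) : B.Path a a := (Walk.nil : B.Walk a a).toPath

/-- Composition of paths: first `f`, then `h`. -/
def comp {a b c : E} (f : B.Path a b) (h : B.Path b c) : B.Path a c :=
  Quotient.map₂ (sa := B.walkSetoid b c) (sb := B.walkSetoid a b)
    (sc := B.walkSetoid a c) Walk.comp
    (fun _ _ h₁ _ _ h₂ => (h₁.comp_right _).trans (h₂.comp_left _)) h f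

/-- The class of the reversed walk. -/
protected def inv {a b : E} (f : B.Path a b) : B.Path b a :=
  Quotient.map (sa := B.walkSetoid a b) (sb := B.walkSetoid b a)
    Walk.reverse (fun _ _ h => h.reverse) f

/-- The class of a single letter. -/
def step {δ : Letter} {a b : E} (h : B.IsStep δ a b) : B.Path a b := (Walk.single δ h).toPath

@[simp]
theorem id_comp {a b : E} (f : B.Path a b) : (Path.id a).comp f = f := by
  obtain ⟨u⟩ := f
  exact congrArg (Quotient.mk _) u.comp_nil

@[simp]
theorem comp_id {a b : E} (f : B.Path a b) : f.comp (Path.id b) = f := by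
  obtain ⟨u⟩ := f
  rfl

@[simp]
theorem comp_assoc {a b c d : E} (f : B.Path a b) (h : B.Path b c) (k : B.Path c d) :
    (f.comp h).comp k = f.comp (h.comp k) := by
  obtain ⟨u⟩ := f
  obtain ⟨v⟩ := h
  obtain ⟨w⟩ := k
  exact congrArg (Quotient.mk _) (Walk.comp_assoc w v u).symm

@[simp]
theorem inv_comp {a b : E} (f : B.Path a b) : f.inv.comp f = Path.id b := by
  obtain ⟨u⟩ := f
  exact u.comp_reverse_self.toPath_eq

@[simp]
theorem comp_inv {a b : E} (f : B.Path a b) : f.comp f.inv = Path.id a := by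
  obtain ⟨u⟩ := f
  exact u.reverse_comp_self.toPath_eq

@[simp]
theorem inv_comp_assoc {a b c : E} (f : B.Path a b) (h : B.Path b c) :
    f.inv.comp (f.comp h) = h := by
  rw [← comp_assoc, inv_comp, id_comp]

theorem inv_id (a : E) : (Path.id a : B.Path a a).inv = Path.id a := by
  rw [← id_comp (Path.inv _), comp_inv]

theorem step_tau_comp_step_tau {a b : E} (h : B.IsStep .tau a b) (h' : B.IsStep .tau b a) :
    (step h).comp (step h') = Path.id a :=
  (Homotopic.tau_tau h h').toPath_eq

@[elab_as_elim]
-- The letter `g⁻¹` needs no case of its own, being the inverse of a `g` step.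
theorem induction {motive : ∀ {a b : E}, B.Path a b → Prop}
    (id : ∀ a : E, motive (Path.id a))
    (comp : ∀ {a b c : E} (f : B.Path a b) (h : B.Path b c),
      motive f → motive h → motive (f.comp h))
    (inv : ∀ {a b : E} (f : B.Path a b), motive f → motive f.inv)
    (g : ∀ {a b : E} (h : B.IsStep .g a b), motive (step h))
    (tau : ∀ {a b : E} (h : B.IsStep .tau a b), motive (step h))
    {a b : E} (f : B.Path a b) : motive f := by
  refine Quotient.ind (motive := fun f => motive f) (fun w => ?_) f
  change motive w.toPath
  clear f
  induction w with
  | nil => exact id a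
  | cons δ h w ih =>
    refine comp w.toPath (step h) ih ?_
    cases δ with
    | g => exact g h
    | gInv => exact inv _ (g h.inv)
    | tau => exact tau h

end Path

open BrauerGSet.Path

variable (B)

/-- The class of the walk `g ^ n` from `x` to `y`. -/
def gPath (n : ℕ) {x y : E} (h : genG ^ n • x = y) : B.Path x y :=
  (h ▸ B.gWalk x n : B.Walk x y).toPath

theorem gPath_congr {m n : ℕ} (hmn : m = n) {x y : E} (h : genG ^ m • x = y) :
    B.gPath m h = B.gPath n (hmn ▸ h) := by
  subst hmn
  rfl

theorem gPath_zero {x : E} (h : genG ^ 0 • x = x) : B.gPath 0 h = Path.id x := by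
  -- `gWalk x 0` is a transported trivial walk; freeing the endpoints lets both transports be
  -- eliminated.
  have key : ∀ (y z : E) (h : z = y) (_ : y = x) (w : B.Walk x z),
      w ≍ (Walk.nil : B.Walk x x) → (h ▸ w : B.Walk x y).toPath ≍ (Path.id x : B.Path x x) := by
    rintro y z rfl rfl w hw
    rw [eq_of_heq hw]
    rfl
  refine eq_of_heq (key _ _ h rfl _ ?_)
  unfold gWalk
  simp

theorem gPath_succ (n : ℕ) {x y z : E} (h : genG ^ n • x = y)
    (h' : genG ^ (n + 1) • x = z) (hs : B.IsStep .g y z) :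
    B.gPath (n + 1) h' = (B.gPath n h).comp (step hs) := by
  subst h h'
  rfl

theorem gPath_add (m n : ℕ) {x y z : E} (h : genG ^ m • x = y) (h' : genG ^ n • y = z)
    (h'' : genG ^ (m + n) • x = z) :
    B.gPath (m + n) h'' = (B.gPath m h).comp (B.gPath n h') := by
  induction n generalizing z with
  | zero =>
    obtain rfl : y = z := by simpa using h'
    rw [B.gPath_zero, comp_id]
    rfl
  | succ n ih =>
    have e : B.IsStep .g (genG ^ n • y) z := by
      change z = _
      rw [← h', pow_succ', mul_smul]
    have e' : genG ^ (m + n) • x = genG ^ n • y := by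
      rw [← h, ← mul_smul, ← pow_add, add_comm]
    rw [B.gPath_succ n rfl h' e, ← comp_assoc, ← ih rfl e']
    exact B.gPath_succ (m + n) e' h'' e

theorem gPath_one {x y : E} (h : genG ^ 1 • x = y) (hs : B.IsStep .g x y) :
    B.gPath 1 h = step hs := by
  rw [B.gPath_succ 0 (by rw [pow_zero, one_smul]) h hs, B.gPath_zero, id_comp]

theorem step_g_comp_gPath (n : ℕ) {x y x' y' : E} (h : genG ^ n • x = x')
    (h' : genG ^ n • y = y') (hs : B.IsStep .g x y) (hs' : B.IsStep .g x' y') :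
    (step hs).comp (B.gPath n h') = (B.gPath n h).comp (step hs') := by
  have e : genG ^ 1 • x = y := by rw [pow_one]; exact hs.symm
  have e₁ : genG ^ (n + 1) • x = y' := by rw [pow_succ', mul_smul, h]; exact hs'.symm
  have e₂ : genG ^ (1 + n) • x = y' := by rw [add_comm, e₁]
  rw [← B.gPath_one e, ← B.gPath_add 1 n e h' e₂, ← B.gPath_succ n h e₁]
  congr 1
  exact add_comm _ _

theorem gPath_comp_step_tau {x y : E} (h : genG ^ B.d x • x = x)
    (h' : genG ^ B.d y • y = y) (hs : B.IsStep .tau x y) :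
    (B.gPath _ h).comp (step hs) = (step hs).comp (B.gPath _ h') := by
  obtain ⟨hx, rfl⟩ := hs
  have key : ∀ (y y' : E) (h : B.σ x = y) (h' : B.σ (B.τ ⟨x, hx⟩ : E) = y')
      (hs : B.IsStep .tau y y'),
      (B.gPath _ h).comp (step hs) = (step (B.isStep_tau ⟨x, hx⟩)).comp (B.gPath _ h') := by
    rintro _ _ rfl rfl hs
    exact (Homotopic.tau_gPow ⟨x, hx⟩).toPath_eq
  exact key _ _ h h' _

variable {B}

theorem d_eq_of_isStep_g {x y : E} (h : B.IsStep .g x y) : B.d y = B.d x :=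
  B.d_orbit y x ⟨genG, h.symm⟩

/-- If `σ` is trivial then the loops `g ^ d(x)` are natural in `x`. -/
theorem gPath_d_comm (hσ : ∀ x, genG ^ B.d x • x = x) {x y : E} (f : B.Path x y) :
    (B.gPath _ (hσ x)).comp f = f.comp (B.gPath _ (hσ y)) := by
  induction f using Path.induction with
  | id => simp
  | comp f h hf hh => rw [← comp_assoc, hf, comp_assoc, hh, comp_assoc]
  | @inv a b f hf =>
    have h := congrArg (fun k => f.inv.comp (k.comp f.inv)) hf
    simp only [comp_assoc, comp_inv, comp_id, inv_comp_assoc] at h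
    exact h.symm
  | @g a b h =>
    have key : ∀ (n : ℕ) (hn : n = B.d a) (hb : genG ^ n • b = b),
        (B.gPath _ (hσ a)).comp (step h) = (step h).comp (B.gPath _ hb) := by
      rintro _ rfl hb
      exact (B.step_g_comp_gPath _ _ _ _ _).symm
    exact key _ (d_eq_of_isStep_g h) _
  | tau h => exact B.gPath_comp_step_tau _ _ h

/-- A closed path at `e`, as an element of the fundamental group. -/
def Path.toGroup {e : E} (f : B.Path e e) : B.FundamentalGroup e := f

theorem Path.toGroup_comp {e : E} (f h : B.Path e e) :
    (f.comp h).toGroup = h.toGroup * f.toGroup := rfl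

theorem Path.toGroup_id (e : E) : (Path.id e : B.Path e e).toGroup = 1 := rfl

/-- The closed path at `e` obtained from `f` by means of paths from `e` to all half-edges. -/
def conj {e : E} (γ : ∀ x, B.Path e x) {x y : E} (f : B.Path x y) : B.FundamentalGroup e :=
  ((γ x).comp (f.comp (γ y).inv)).toGroup

theorem conj_id {e : E} (γ : ∀ x, B.Path e x) (x : E) : conj γ (Path.id x) = 1 := by
  rw [conj, id_comp, comp_inv, toGroup_id]

/-- The factors swap because paths compose from left to right, whereas the group product `[u] [v]`
traverses `v` first. -/
theorem conj_comp {e : E} (γ : ∀ x, B.Path e x) {x y z : E} (f : B.Path x y) (h : B.Path y z) :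
    conj γ (f.comp h) = conj γ h * conj γ f := by
  simp [conj, ← toGroup_comp]

theorem conj_inv {e : E} (γ : ∀ x, B.Path e x) {x y : E} (f : B.Path x y) :
    conj γ f.inv = (conj γ f)⁻¹ := by
  rw [eq_inv_iff_mul_eq_one, ← conj_comp, comp_inv, conj_id]

theorem conj_self {e : E} (γ : ∀ x, B.Path e x) (h : γ e = Path.id e) (f : B.Path e e) :
    conj γ f = f.toGroup := by
  rw [conj, h, inv_id, comp_id, id_comp]

/-- The loops `g ^ d(x)` all induce the same element of the fundamental group. -/
theorem conj_gPath_d {e : E} (γ : ∀ x, B.Path e x) (hσ : ∀ x, genG ^ B.d x • x = x) (x : E) :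
    conj γ (B.gPath _ (hσ x)) = (B.gPath _ (hσ e)).toGroup := by
  rw [conj, ← comp_assoc, ← gPath_d_comm hσ (γ x), comp_assoc, comp_inv, comp_id]

/-- Centrality is naturality of the loops applied to `u`, itself a path from `e` to `e`. -/
theorem conj_gPath_d_comm {e : E} (γ : ∀ x, B.Path e x) (hσ : ∀ x, genG ^ B.d x • x = x) (x : E)
    (u : B.FundamentalGroup e) :
    conj γ (B.gPath _ (hσ x)) * u = u * conj γ (B.gPath _ (hσ x)) := by
  rw [conj_gPath_d]
  exact (gPath_d_comm hσ (x := e) (y := e) u).symm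

/-- Loops at `x` of the form `g ^ (c * m)` are powers. -/
theorem conj_gPath_mul {e : E} (γ : ∀ x, B.Path e x) {m : ℕ} {x : E} (h : genG ^ m • x = x)
    (c : ℕ) (h' : genG ^ (c * m) • x = x) :
    conj γ (B.gPath _ h') = conj γ (B.gPath _ h) ^ c := by
  induction c with
  | zero =>
    have key : ∀ (n : ℕ) (_ : n = 0) (h : genG ^ n • x = x), B.gPath n h = Path.id x := by
      rintro _ rfl h
      exact B.gPath_zero h
    rw [key _ (zero_mul m), conj_id, pow_zero]
  | succ c ih =>
    have e : genG ^ (c * m) • x = x := by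
      rw [Nat.succ_mul, add_comm, pow_add, mul_smul] at h'
      rw [← smul_left_cancel_iff (genG ^ m), h', h]
    have key : ∀ (n : ℕ) (_ : n = c * m + m) (h' : genG ^ n • x = x),
        conj γ (B.gPath _ h') = conj γ (B.gPath _ h) ^ (c + 1) := by
      rintro _ rfl h'
      rw [B.gPath_add _ _ e h, conj_comp, ih e, pow_succ']
    exact key _ (Nat.succ_mul c m) h'

end Path

/-! ### Labelling walks by elements of a group. -/

section Eval

variable {E : Type*} [MulAction (Multiplicative ℤ) E] {B : BrauerGSet E}
  {H : Type*} [Group H] (lg : E → H) (lt : B.U → H)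

open Classical in
/-- The label of a letter that is read at `a` and leads to `b`. -/
noncomputable def letterLabel : Letter → E → E → H
  | .g, a, _ => lg a
  | .gInv, _, b => (lg b)⁻¹
  | .tau, a, _ => if h : a ∈ B.U then lt ⟨a, h⟩ else 1

/-- The product of the labels of a walk. -/
noncomputable def Walk.label {a : E} : ∀ {b : E}, B.Walk a b → H
  | _, .nil => 1
  | _, @Walk.cons _ _ _ _ b c δ _ w => letterLabel lg lt δ b c * Walk.label w

theorem Walk.label_comp {a b c : E} (u : B.Walk b c) (v : B.Walk a b) :
    (u.comp v).label lg lt = u.label lg lt * v.label lg lt := by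
  induction u with
  | nil => exact (one_mul _).symm
  | cons δ h u ih => simp [Walk.comp, Walk.label, ih, mul_assoc]

theorem Walk.label_single_tau {a b : E} (ha : a ∈ B.U) (h : B.IsStep .tau a b) :
    (Walk.single .tau h).label lg lt = lt ⟨a, ha⟩ := by
  simp [Walk.single, Walk.label, letterLabel, ha]

/-- Compatibility of a labelling with the defining relations of homotopy. -/
structure IsCompatible : Prop where
  tau_tau : ∀ x : B.U, lt (B.τ x) * lt x = 1
  tau_g : ∀ x : B.U, lt ⟨B.σ (x : E), B.σ_mem x⟩ * (B.gWalk (x : E) (B.d x)).label lg lt =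
    (B.gWalk (B.τ x : E) (B.d (B.τ x : E))).label lg lt * lt x

variable {lg lt}

/-- Cancellation of `g` against `g⁻¹` is built into `letterLabel`; only the two relations involving
`τ` use `hl`. -/
theorem Homotopic.label_eq (hl : IsCompatible lg lt) {a b : E} {u v : B.Walk a b}
    (h : B.Homotopic u v) : u.label lg lt = v.label lg lt := by
  induction h with
  | refl => rfl
  | symm _ ih => exact ih.symm
  | trans _ _ ih₁ ih₂ => exact ih₁.trans ih₂
  | gInv_g h₁ h₂ => simp [Walk.label_comp, Walk.single, Walk.label, letterLabel]
  | g_gInv h₁ h₂ => simp [Walk.label_comp, Walk.single, Walk.label, letterLabel]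
  | tau_tau h₁ h₂ =>
    obtain ⟨x, rfl, rfl⟩ := isStep_tau_iff.1 h₁
    rw [Walk.label_comp, Walk.label_single_tau _ _ x.2, Walk.label_single_tau _ _ (B.τ x).2]
    exact hl.tau_tau _
  | tau_gPow x =>
    rw [Walk.label_comp, Walk.label_comp, Walk.label_single_tau _ _ x.2,
      Walk.label_single_tau _ _ (B.σ_mem x)]
    exact hl.tau_g x
  | comp_left u _ ih => rw [Walk.label_comp, Walk.label_comp, ih]
  | comp_right v _ ih => rw [Walk.label_comp, Walk.label_comp, ih]

/-- The label of a homotopy class. -/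
noncomputable def Path.label (hl : IsCompatible lg lt) {a b : E} (f : B.Path a b) : H :=
  Quotient.lift (s := B.walkSetoid a b) (Walk.label lg lt) (fun _ _ h => h.label_eq hl) f

variable (hl : IsCompatible lg lt)

theorem Path.label_id (a : E) : (Path.id a : B.Path a a).label hl = 1 := rfl

theorem Path.label_comp {a b c : E} (f : B.Path a b) (h : B.Path b c) :
    (f.comp h).label hl = h.label hl * f.label hl := by
  obtain ⟨u⟩ := f
  obtain ⟨v⟩ := h
  exact Walk.label_comp lg lt v u

theorem Path.label_inv {a b : E} (f : B.Path a b) : f.inv.label hl = (f.label hl)⁻¹ := by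
  rw [eq_inv_iff_mul_eq_one, ← Path.label_comp, Path.comp_inv, Path.label_id]

theorem Path.label_step_g {a b : E} (h : B.IsStep .g a b) : (Path.step h).label hl = lg a :=
  mul_one _

theorem Path.label_step_tau {a b : E} (h : B.IsStep .tau a b) (ha : a ∈ B.U) :
    (Path.step h).label hl = lt ⟨a, ha⟩ :=
  Walk.label_single_tau lg lt ha h

/-- The homomorphism from the fundamental group that is induced by a labelling. -/
noncomputable def labelHom (e : E) : B.FundamentalGroup e →* H where
  toFun f := Path.label hl (a := e) (b := e) f
  map_one' := rfl
  map_mul' f h := Path.label_comp hl (a := e) (b := e) (c := e) h f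

theorem labelHom_conj {e : E} (γ : ∀ x, B.Path e x) (hγ : ∀ x, (γ x).label hl = 1)
    {x y : E} (f : B.Path x y) : labelHom hl e (conj γ f) = f.label hl := by
  change Path.label hl ((γ x).comp (f.comp (γ y).inv)) = _
  rw [Path.label_comp, Path.label_comp, Path.label_inv, hγ, hγ, inv_one, one_mul, mul_one]

/-- A homomorphism that is inverse to the labelling on letters is inverse to it. -/
theorem map_label_eq_conj {e : E} (γ : ∀ x, B.Path e x) (ψ : H →* B.FundamentalGroup e)
    (hg : ∀ {a b : E} (h : B.IsStep .g a b), ψ (lg a) = conj γ (Path.step h))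
    (ht : ∀ x : B.U, ψ (lt x) = conj γ (Path.step (B.isStep_tau x)))
    {x y : E} (f : B.Path x y) : ψ (f.label hl) = conj γ f := by
  induction f using Path.induction with
  | id a => rw [Path.label_id, map_one, conj_id]
  | comp f h hf hh => rw [Path.label_comp, map_mul, hf, hh, conj_comp]
  | inv f hf => rw [Path.label_inv, map_inv, hf, conj_inv]
  | g h => rw [Path.label_step_g, hg h]
  | tau h =>
    obtain ⟨x, rfl, rfl⟩ := isStep_tau_iff.1 h
    rw [Path.label_step_tau hl _ x.2, ht]

end Eval

open BrauerGSet.Path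

/-! ### Orbit sizes and powers of the generator. -/

section Vertex

variable {E : Type*} [MulAction (Multiplicative ℤ) E] (B : BrauerGSet E)

/-- The vertex of a half-edge. -/
def vertex (x : E) : B.Vertex := Quotient.mk (MulAction.orbitRel (Multiplicative ℤ) E) x

theorem vertex_eq_iff {x y : E} :
    B.vertex x = B.vertex y ↔ x ∈ MulAction.orbit (Multiplicative ℤ) y :=
  Quotient.eq (r := MulAction.orbitRel (Multiplicative ℤ) E)

theorem vertex_smul (a : Multiplicative ℤ) (x : E) : B.vertex (a • x) = B.vertex x :=
  B.vertex_eq_iff.2 ⟨a, rfl⟩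

theorem vertex_surjective : Function.Surjective B.vertex := Quotient.mk_surjective

/-- The number of half-edges at a vertex. -/
noncomputable def vertexCard (v : B.Vertex) : ℕ := v.orbit.ncard

theorem vertexCard_vertex (x : E) :
    B.vertexCard (B.vertex x) = (MulAction.orbit (Multiplicative ℤ) x).ncard := rfl

theorem minimalPeriod_eq_vertexCard [Finite E] (x : E) :
    Function.minimalPeriod (genG • ·) x = B.vertexCard (B.vertex x) := by
  classical
  have := Fintype.ofFinite (MulAction.orbit (Subgroup.zpowers genG) x)
  rw [MulAction.minimalPeriod_eq_card, vertexCard_vertex, ← Nat.card_eq_fintype_card,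
    Nat.card_coe_set_eq]
  congr 1
  ext y
  constructor
  · rintro ⟨⟨a, _⟩, rfl⟩
    exact ⟨a, rfl⟩
  · rintro ⟨a, rfl⟩
    exact ⟨⟨a, Multiplicative.toAdd a, by simp [← ofAdd_zsmul]⟩, rfl⟩

theorem pow_smul_eq_self_iff [Finite E] (x : E) (m : ℕ) :
    genG ^ m • x = x ↔ B.vertexCard (B.vertex x) ∣ m := by
  rw [← B.minimalPeriod_eq_vertexCard, MulAction.pow_smul_eq_iff_minimalPeriod_dvd]

theorem vertexCard_pos [Finite E] (v : B.Vertex) : 0 < B.vertexCard v := by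
  obtain ⟨x, rfl⟩ := B.vertex_surjective v
  rw [vertexCard_vertex]
  exact (Set.ncard_pos (Set.toFinite _)).2 (MulAction.nonempty_orbit x)

theorem exists_pow_smul_eq [Finite E] {x y : E} (h : B.vertex x = B.vertex y) :
    ∃ p < B.vertexCard (B.vertex x), genG ^ p • x = y := by
  obtain ⟨a, rfl⟩ := B.vertex_eq_iff.1 h.symm
  have hc : (0 : ℤ) < B.vertexCard (B.vertex x) := by exact_mod_cast B.vertexCard_pos _
  set c := B.vertexCard (B.vertex x)
  obtain ⟨z, rfl⟩ : ∃ z : ℤ, a = genG ^ z := ⟨a.toAdd, by rw [← ofAdd_zsmul]; simp⟩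
  have h₀ := Int.emod_nonneg z hc.ne'
  refine ⟨(z % c).toNat, by have := Int.emod_lt_of_pos z hc; omega, ?_⟩
  have hx : genG ^ (c : ℤ) • x = x := by
    rw [zpow_natCast]; exact (B.pow_smul_eq_self_iff x c).2 dvd_rfl
  rw [← zpow_natCast, Int.toNat_of_nonneg h₀]
  have hx' : genG ^ (c * (z / c) : ℤ) • x = x := by
    rw [zpow_mul]
    exact (MulAction.mem_stabilizer_iff.1 (zpow_mem (MulAction.mem_stabilizer_iff.2 hx) _))
  change _ = genG ^ z • x
  conv_rhs => rw [← Int.emod_add_mul_ediv z c, zpow_add, mul_smul, hx']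

/-- The form in which integrality is used: `d(v)` steps are a whole number of turns around `v`. -/
theorem vertexDegree_eq [Finite E] {v : B.Vertex} {d : ℕ} (h : B.fDegree v = d) :
    B.vertexDegree v = d * B.vertexCard v := by
  have hc : (B.vertexCard v : ℚ) ≠ 0 := by exact_mod_cast (B.vertexCard_pos v).ne'
  have h' : (B.vertexDegree v : ℚ) / B.vertexCard v = d := h
  rw [div_eq_iff hc] at h'
  exact_mod_cast h'

end Vertex

/-! ### Rooted spanning trees and paths along them. -/

/-- A choice of a half-edge at each vertex, which is the given half-edge `e` at the root and
which leads to a vertex of smaller rank at all other vertices. -/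
structure RootedTree {E : Type*} [MulAction (Multiplicative ℤ) E] (B : BrauerGSet E) (e : E) where
  /-- the base half-edge of a vertex -/
  base : B.Vertex → E
  vertex_base : ∀ v, B.vertex (base v) = v
  base_root : base (B.vertex e) = e
  base_mem : ∀ v, v ≠ B.vertex e → base v ∈ B.U
  /-- the rank of a vertex, which decreases towards the root -/
  rank : B.Vertex → ℕ
  rank_lt : ∀ v (h : v ≠ B.vertex e), rank (B.vertex (B.τ ⟨base v, base_mem v h⟩)) < rank v

section Exists

variable {E : Type*} [MulAction (Multiplicative ℤ) E] {B : BrauerGSet E}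

/-- The number of letters of a walk. -/
def Walk.length {a : E} : ∀ {b : E}, B.Walk a b → ℕ
  | _, .nil => 0
  | _, .cons _ _ w => Walk.length w + 1

/-- The rank of `v` is the least length of a walk from `e` to a half-edge at `v`. The last letter of
a shortest walk cannot be `g` or `g⁻¹`, which stay at the same vertex; so it is `τ`, and reading it
backwards lowers the rank. -/
theorem exists_rootedTree (hconn : B.Connected) (e : E) : Nonempty (B.RootedTree e) := by
  classical
  have hex : ∀ v : B.Vertex, ∃ m : ℕ, ∃ x : E, B.vertex x = v ∧ ∃ w : B.Walk e x, w.length = m := by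
    intro v
    obtain ⟨x, rfl⟩ := B.vertex_surjective v
    obtain ⟨w⟩ := hconn e x
    exact ⟨_, x, rfl, w, rfl⟩
  let rank : B.Vertex → ℕ := fun v => Nat.find (hex v)
  have hrank : ∀ {x : E} (w : B.Walk e x), rank (B.vertex x) ≤ w.length := fun {x} w =>
    Nat.find_min' (hex _) ⟨x, rfl, w, rfl⟩
  have key : ∀ v : B.Vertex, ∃ x : E, B.vertex x = v ∧ (v = B.vertex e → x = e) ∧
      (v ≠ B.vertex e → ∃ h : x ∈ B.U, rank (B.vertex (B.τ ⟨x, h⟩)) < rank v) := by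
    intro v
    by_cases hv : v = B.vertex e
    · exact ⟨e, hv.symm, fun _ => rfl, fun h => absurd hv h⟩
    obtain ⟨x, hx, w, hw⟩ := Nat.find_spec (hex v)
    refine ⟨x, hx, fun h => absurd h hv, fun _ => ?_⟩
    cases w with
    | nil => exact absurd hx.symm hv
    | @cons b _ δ h w =>
      have hb : rank (B.vertex b) < rank v :=
        (hrank w).trans_lt (Nat.lt_of_succ_le hw.le)
      cases δ with
      | g =>
        obtain rfl : x = genG • b := h
        rw [vertex_smul] at hx
        exact absurd hb (hx ▸ lt_irrefl _)
      | gInv =>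
        obtain rfl : x = genG⁻¹ • b := h
        rw [vertex_smul] at hx
        exact absurd hb (hx ▸ lt_irrefl _)
      | tau =>
        obtain ⟨y, rfl, rfl⟩ := isStep_tau_iff.1 h
        exact ⟨(B.τ y).2, by rwa [Subtype.coe_eta, B.τ_involutive]⟩
  choose base h₁ h₂ h₃ using key
  exact ⟨⟨base, h₁, h₂ _ rfl, fun v hv => (h₃ v hv).1, rank, fun v hv => (h₃ v hv).2⟩⟩

end Exists

namespace RootedTree

variable {E : Type*} [MulAction (Multiplicative ℤ) E] {B : BrauerGSet E} {e : E}
  (T : B.RootedTree e)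

theorem _root_.BrauerGSet.isStep_τ_tau (x : B.U) : B.IsStep .tau (B.τ x : E) x :=
  isStep_tau_iff.2 ⟨B.τ x, rfl, by rw [B.τ_involutive]⟩

/-- The half-edges of the edges of the tree. -/
def IsTree (x : B.U) : Prop :=
  ∃ v, v ≠ B.vertex e ∧ ((x : E) = T.base v ∨ (B.τ x : E) = T.base v)

theorem isTree_τ {x : B.U} : T.IsTree (B.τ x) ↔ T.IsTree x := by
  simp only [IsTree, B.τ_involutive x, or_comm]

theorem base_injective : Function.Injective T.base := fun v w h => by
  rw [← T.vertex_base v, h, T.vertex_base]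

theorem rank_τ_lt {v : B.Vertex} (hv : v ≠ B.vertex e) {x : B.U} (hx : (x : E) = T.base v) :
    T.rank (B.vertex (B.τ x)) < T.rank (B.vertex x) := by
  have := T.rank_lt v hv
  simp only [← hx, Subtype.coe_eta] at this
  rwa [hx, T.vertex_base]

/-- The rank changes strictly across a tree edge, so a double half-edge never lies in the tree. -/
theorem τ_ne_of_isTree {x : B.U} (hx : T.IsTree x) : B.τ x ≠ x := by
  obtain ⟨v, hv, h | h⟩ := hx
  · intro h'
    have := T.rank_τ_lt hv h
    rw [h'] at this
    exact lt_irrefl _ this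
  · intro h'
    have := T.rank_τ_lt hv h
    rw [h', h'] at this
    exact lt_irrefl _ this

theorem exists_pos [Finite E] (x : E) :
    ∃ p < B.vertexCard (B.vertex x), genG ^ p • T.base (B.vertex x) = x := by
  simpa only [T.vertex_base] using B.exists_pow_smul_eq (T.vertex_base (B.vertex x))

/-- The distance of a half-edge from the base half-edge at its vertex. -/
noncomputable def pos [Finite E] (x : E) : ℕ := (T.exists_pos x).choose

variable [Finite E]

theorem pos_lt (x : E) : T.pos x < B.vertexCard (B.vertex x) := (T.exists_pos x).choose_spec.1

theorem pow_pos_smul (x : E) : genG ^ T.pos x • T.base (B.vertex x) = x :=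
  (T.exists_pos x).choose_spec.2

/-- Paths from the root along the tree to the base half-edges. -/
noncomputable def basePath (v : B.Vertex) : B.Path e (T.base v) :=
  open Classical in
  if h : v = B.vertex e then B.gPath 0 (by rw [h, T.base_root, pow_zero, one_smul])
  else
    (basePath (B.vertex (B.τ ⟨T.base v, T.base_mem v h⟩))).comp
      ((B.gPath _ (T.pow_pos_smul _)).comp (step (B.isStep_τ_tau ⟨T.base v, T.base_mem v h⟩)))
termination_by T.rank v
decreasing_by exact T.rank_lt v h

/-- Paths from the root along the tree. -/
noncomputable def path (x : E) : B.Path e x :=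
  (T.basePath (B.vertex x)).comp (B.gPath _ (T.pow_pos_smul x))

theorem pow_smul_base_eq_iff (v : B.Vertex) (m : ℕ) :
    genG ^ m • T.base v = T.base v ↔ B.vertexCard v ∣ m := by
  rw [B.pow_smul_eq_self_iff, T.vertex_base]

/-- A position below the orbit size is unique, so `T.path x` does not depend on how the position was
chosen. -/
theorem path_eq {v : B.Vertex} {p : ℕ} (hp : p < B.vertexCard v) {x : E}
    (h : genG ^ p • T.base v = x) : T.path x = (T.basePath v).comp (B.gPath p h) := by
  obtain rfl : B.vertex x = v := by rw [← h, vertex_smul, T.vertex_base]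
  have key : ∀ {p q : ℕ}, p ≤ q → q < B.vertexCard (B.vertex x) →
      genG ^ p • T.base (B.vertex x) = x → genG ^ q • T.base (B.vertex x) = x → p = q := by
    intro p q hpq hq h₁ h₂
    rw [← h₁, ← Nat.add_sub_of_le hpq, pow_add, mul_smul, smul_left_cancel_iff,
      h₁, T.pow_smul_base_eq_iff] at h₂
    have := Nat.eq_zero_of_dvd_of_lt h₂ (by omega)
    omega
  have hpos : T.pos x = p := by
    rcases le_total p (T.pos x) with h' | h'
    · exact (key h' (T.pos_lt x) h (T.pow_pos_smul x)).symm
    · exact key h' hp (T.pow_pos_smul x) h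
  subst hpos
  rfl

theorem path_base (v : B.Vertex) : T.path (T.base v) = T.basePath v := by
  rw [T.path_eq (B.vertexCard_pos v) (by rw [pow_zero, one_smul]), B.gPath_zero, comp_id]

theorem path_root : T.path e = Path.id e := by
  have h := T.path_eq (p := 0) (B.vertexCard_pos (B.vertex e)) (x := e)
    (by rw [pow_zero, one_smul, T.base_root])
  rw [h, basePath, dif_pos rfl, ← B.gPath_add 0 0 _ _ (by rw [pow_zero, one_smul])]
  exact B.gPath_zero _

theorem path_tree {v : B.Vertex} (hv : v ≠ B.vertex e) {x : B.U} (hx : (x : E) = T.base v) :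
    T.path x = (T.path (B.τ x)).comp (step (B.isStep_τ_tau x)) := by
  obtain ⟨x, h⟩ := x
  subst hx
  rw [path_base, basePath, dif_neg hv, path, comp_assoc]

end RootedTree
-- Labels of powers of `g`.
section gProd

variable {E : Type*} [MulAction (Multiplicative ℤ) E] {B : BrauerGSet E}
  {H : Type*} [Group H] (lg : E → H) (lt : B.U → H)

/-- The product of the labels of the walk `g ^ n` at `x`. -/
def gProd (x : E) : ℕ → H
  | 0 => 1
  | n + 1 => lg (genG ^ n • x) * gProd x n

theorem gProd_add (x : E) (m n : ℕ) :
    gProd lg x (m + n) = gProd lg (genG ^ m • x) n * gProd lg x m := by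
  induction n with
  | zero => exact (one_mul _).symm
  | succ n ih =>
    rw [← add_assoc, gProd, gProd, ih, ← mul_smul, ← pow_add, add_comm n m, mul_assoc]

theorem label_gWalk (x : E) (n : ℕ) : (B.gWalk x n).label lg lt = gProd lg x n := by
  induction n with
  | zero =>
    have key : ∀ (z : E) (_ : z = x) (w : B.Walk x z), w ≍ (Walk.nil : B.Walk x x) →
        w.label lg lt = 1 := by
      rintro z rfl w hw
      rw [eq_of_heq hw]
      rfl
    refine key _ (by rw [pow_zero, one_smul]) _ ?_
    unfold gWalk
    simp
  | succ n ih => exact congrArg (lg (genG ^ n • x) * ·) ih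

theorem label_gPath {lg : E → H} {lt : B.U → H} (hl : IsCompatible lg lt) (n : ℕ) {x y : E}
    (h : genG ^ n • x = y) : (B.gPath n h).label hl = gProd lg x n := by
  subst h
  exact label_gWalk lg lt x n

end gProd

/-! ### The labelling attached to a tree. -/

namespace RootedTree

variable {E : Type*} [MulAction (Multiplicative ℤ) E] {B : BrauerGSet E} {e : E}
  (T : B.RootedTree e) [Finite E] {H : Type*} [Group H] (a : B.Vertex → H) (t : B.U → H)

open Classical in
/-- The labelling of the letters `g` for which `g ^ |v|` at the base half-edge of `v` has the
label `a v`. -/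
noncomputable def gLabel (x : E) : H :=
  if genG • x = T.base (B.vertex x) then a (B.vertex x) else 1

/-- Only a step arriving at the base contributes, once per completed turn; hence the floor of `m /
|v|`. -/
theorem gProd_gLabel_base (v : B.Vertex) (m : ℕ) :
    gProd (T.gLabel a) (T.base v) m = a v ^ (m / B.vertexCard v) := by
  induction m with
  | zero => simp [gProd]
  | succ m ih =>
    rw [gProd, ih, gLabel, vertex_smul, T.vertex_base, ← mul_smul, ← pow_succ', Nat.succ_div]
    simp only [T.pow_smul_base_eq_iff]
    split_ifs
    · rw [pow_succ']
    · rw [one_mul, add_zero]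

/-- Prepending the `T.pos x` steps from the base to `x` changes nothing: they are less than a turn
and have label 1. -/
theorem gProd_gLabel_mul (x : E) (c : ℕ) :
    gProd (T.gLabel a) x (c * B.vertexCard (B.vertex x)) = a (B.vertex x) ^ c := by
  have hc := B.vertexCard_pos (B.vertex x)
  have h := gProd_add (T.gLabel a) (T.base (B.vertex x)) (T.pos x)
    (c * B.vertexCard (B.vertex x))
  rw [T.pow_pos_smul, gProd_gLabel_base, gProd_gLabel_base, Nat.add_mul_div_right _ _ hc,
    Nat.div_eq_of_lt (T.pos_lt x), zero_add, pow_zero, mul_one] at h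
  exact h.symm

/-- The conditions for a labelling of the letters `τ`. -/
structure IsTauLabel (f : B.Vertex → ℕ) : Prop where
  degree : ∀ v, B.vertexDegree v = f v * B.vertexCard v
  pow_eq : ∀ v w, a v ^ f v = a w ^ f w
  pow_comm : ∀ v x, a v ^ f v * t x = t x * a v ^ f v
  tau_tau : ∀ x, t (B.τ x) * t x = 1
  tree : ∀ x, T.IsTree x → t x = 1

variable {T a t} {f : B.Vertex → ℕ}

theorem IsTauLabel.gProd_d (h : T.IsTauLabel a t f) (x : E) :
    gProd (T.gLabel a) x (B.d x) = a (B.vertex x) ^ f (B.vertex x) := by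
  rw [← T.gProd_gLabel_mul, ← h.degree]
  rfl

theorem σ_eq_self_of_degree (h : ∀ v, B.vertexDegree v = f v * B.vertexCard v) (x : E) :
    genG ^ B.d x • x = x :=
  (B.pow_smul_eq_self_iff x _).2 ⟨f (B.vertex x), (h (B.vertex x)).trans (mul_comm _ _)⟩

theorem IsTauLabel.isCompatible (h : T.IsTauLabel a t f) : IsCompatible (T.gLabel a) t where
  tau_tau := h.tau_tau
  tau_g x := by
    have hx : (⟨B.σ (x : E), B.σ_mem x⟩ : B.U) = x :=
      Subtype.ext (σ_eq_self_of_degree h.degree x)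
    rw [label_gWalk, label_gWalk, h.gProd_d, h.gProd_d, hx, ← h.pow_comm,
      h.pow_eq (B.vertex x)]

/-- Induction on the rank: tree paths cross tree edges only, and at each vertex they turn by less
than a full turn. -/
theorem IsTauLabel.label_basePath (h : T.IsTauLabel a t f) (v : B.Vertex) :
    (T.basePath v).label h.isCompatible = 1 := by
  induction hn : T.rank v using Nat.strong_induction_on generalizing v with
  | _ n ih =>
    rw [basePath]
    split_ifs with hv
    · rw [label_gPath]
      rfl
    · rw [Path.label_comp, Path.label_comp, label_gPath, gProd_gLabel_base,
        Nat.div_eq_of_lt (T.pos_lt _), ih _ (hn ▸ T.rank_lt v hv) _ rfl,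
        Path.label_step_tau _ _ (Subtype.coe_prop _), Subtype.coe_eta, h.tree, pow_zero, mul_one,
        mul_one]
      exact T.isTree_τ.2 ⟨v, hv, .inl rfl⟩

theorem IsTauLabel.label_path (h : T.IsTauLabel a t f) (x : E) :
    (T.path x).label h.isCompatible = 1 := by
  rw [path, Path.label_comp, h.label_basePath, label_gPath, gProd_gLabel_base,
    Nat.div_eq_of_lt (T.pos_lt _), pow_zero, mul_one]

/-! ### Loops at the root obtained from single letters. -/

variable (T)

/-- The loop `g ^ |v|` at the base half-edge of `v`. -/
noncomputable def vertexLoop (v : B.Vertex) : B.FundamentalGroup e :=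
  conj T.path (B.gPath _ ((T.pow_smul_base_eq_iff v _).2 dvd_rfl))

/-- The loop through the half-edge `x`. -/
noncomputable def tauLoop (x : B.U) : B.FundamentalGroup e :=
  conj T.path (step (B.isStep_tau x))

theorem tauLoop_tauLoop (x : B.U) : T.tauLoop (B.τ x) * T.tauLoop x = 1 := by
  have key : ∀ (y : E) (_ : y = x) (h : B.IsStep .tau (B.τ x : E) y),
      conj T.path (step h) * T.tauLoop x = 1 := by
    rintro _ rfl h
    rw [tauLoop, ← conj_comp, step_tau_comp_step_tau, conj_id]
  exact key _ (congrArg Subtype.val (B.τ_involutive x)) _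

/-- The tree path to a base half-edge `x` ends by crossing from `B.τ x`, so crossing back cancels
it. -/
theorem tauLoop_eq_one {x : B.U} (hx : T.IsTree x) : T.tauLoop x = 1 := by
  have key : ∀ {v : B.Vertex} {x : B.U}, v ≠ B.vertex e → (x : E) = T.base v →
      T.tauLoop x = 1 := by
    intro v x hv hx
    rw [tauLoop, conj, T.path_tree hv hx, comp_assoc, ← comp_assoc (step _),
      step_tau_comp_step_tau, id_comp, comp_inv, toGroup_id]
  obtain ⟨v, hv, h | h⟩ := hx
  · exact key hv h
  · have := T.tauLoop_tauLoop x
    rwa [key hv h, one_mul] at this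

open Classical in
-- A `g` step prolongs the tree path of `x` to that of `y`, unless it closes the turn at the base.
-- This matches the case distinction in `gLabel`.
theorem conj_step_g {x y : E} (h : B.IsStep .g x y) :
    conj T.path (step h) =
      if y = T.base (B.vertex x) then T.vertexLoop (B.vertex x) else 1 := by
  have hpos := T.pow_pos_smul x
  have hlt := T.pos_lt x
  have hy : genG ^ (T.pos x + 1) • T.base (B.vertex x) = y := by
    rw [pow_succ', mul_smul, hpos]; exact h.symm
  have hcomp : (T.path x).comp (step h) = (T.basePath (B.vertex x)).comp (B.gPath _ hy) := by
    rw [B.gPath_succ _ hpos hy h, path, comp_assoc]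
  split_ifs with hb
  · subst hb
    have hc : T.pos x + 1 = B.vertexCard (B.vertex x) :=
      le_antisymm hlt (Nat.le_of_dvd (Nat.succ_pos _) ((T.pow_smul_base_eq_iff _ _).1 hy))
    rw [conj, ← comp_assoc, hcomp, vertexLoop, conj, T.path_base, comp_assoc]
    rw [B.gPath_congr hc]
  · have hlt' : T.pos x + 1 < B.vertexCard (B.vertex x) := by
      refine lt_of_le_of_ne hlt fun hc => hb ?_
      rw [← hy, T.pow_smul_base_eq_iff, hc]
    rw [conj, ← comp_assoc, hcomp, ← T.path_eq hlt' hy, comp_inv, toGroup_id]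

theorem vertexLoop_pow (h : ∀ v, B.vertexDegree v = f v * B.vertexCard v) (v : B.Vertex) :
    T.vertexLoop v ^ f v = conj T.path (B.gPath _ (σ_eq_self_of_degree h (T.base v))) := by
  have hd : B.d (T.base v) = f v * B.vertexCard v := by
    rw [← h v]
    exact congrArg B.vertexDegree (T.vertex_base v)
  have key : ∀ (n : ℕ) (_ : n = f v * B.vertexCard v) (h : genG ^ n • T.base v = T.base v),
      T.vertexLoop v ^ f v = conj T.path (B.gPath _ h) := by
    rintro _ rfl h
    exact (conj_gPath_mul _ _ _ _).symm
  exact key _ hd _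

theorem vertexLoop_pow_eq (h : ∀ v, B.vertexDegree v = f v * B.vertexCard v) (v w : B.Vertex) :
    T.vertexLoop v ^ f v = T.vertexLoop w ^ f w := by
  rw [T.vertexLoop_pow h, T.vertexLoop_pow h, conj_gPath_d, conj_gPath_d _ _ (T.base w)]

theorem vertexLoop_pow_comm (h : ∀ v, B.vertexDegree v = f v * B.vertexCard v) (v : B.Vertex)
    (u : B.FundamentalGroup e) : T.vertexLoop v ^ f v * u = u * T.vertexLoop v ^ f v := by
  rw [T.vertexLoop_pow h, conj_gPath_d_comm]

variable {T}

/-- A homomorphism that sends labels to the corresponding loops inverts the labelling. -/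
theorem IsTauLabel.map_labelHom (h : T.IsTauLabel a t f) (ψ : H →* B.FundamentalGroup e)
    (ha : ∀ v, ψ (a v) = T.vertexLoop v) (ht : ∀ x, ψ (t x) = T.tauLoop x)
    (u : B.FundamentalGroup e) : ψ (labelHom h.isCompatible e u) = u := by
  refine (map_label_eq_conj h.isCompatible T.path ψ (fun {x y} hs => ?_) ht
    (x := e) (y := e) u).trans (conj_self T.path T.path_root u)
  rw [T.conj_step_g, gLabel]
  obtain rfl : y = genG • x := hs
  split_ifs
  · exact ha _
  · exact map_one ψ

theorem IsTauLabel.labelHom_vertexLoop (h : T.IsTauLabel a t f) (v : B.Vertex) :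
    labelHom h.isCompatible e (T.vertexLoop v) = a v := by
  rw [vertexLoop, labelHom_conj _ _ h.label_path, label_gPath, gProd_gLabel_base,
    Nat.div_self (B.vertexCard_pos v), pow_one]

theorem IsTauLabel.labelHom_tauLoop (h : T.IsTauLabel a t f) (x : B.U) :
    labelHom h.isCompatible e (T.tauLoop x) = t x := by
  rw [tauLoop, labelHom_conj _ _ h.label_path, Path.label_step_tau _ _ x.2]

/-! ### Counting the edges inside and outside the tree. -/

section Count

variable {E : Type*} [MulAction (Multiplicative ℤ) E] {B : BrauerGSet E} {e : E}
  (T : B.RootedTree e) (ι : E → ℕ)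

/-- One half-edge from each edge that is not in the tree. -/
def cotree : Set B.U := {x | ¬ T.IsTree x ∧ ι x < ι (B.τ x)}

/-- The base half-edges of the vertices other than the root. -/
def parents : Set B.U := {x | ∃ v, v ≠ B.vertex e ∧ (x : E) = T.base v}

theorem ncard_parents [Finite E] : T.parents.ncard + 1 = Nat.card B.Vertex := by
  have : Finite B.Vertex := Finite.of_surjective _ B.vertex_surjective
  have h : T.parents.ncard = ({B.vertex e}ᶜ : Set B.Vertex).ncard := by
    symm
    refine Set.ncard_congr (fun v hv => ⟨T.base v, T.base_mem v hv⟩) ?_ ?_ ?_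
    · exact fun v hv => ⟨v, hv, rfl⟩
    · exact fun v w _ _ h => T.base_injective (congrArg Subtype.val h)
    · rintro x ⟨v, hv, hx⟩
      exact ⟨v, hv, Subtype.ext hx.symm⟩
  rw [h, ← Set.ncard_add_ncard_compl {B.vertex e}, Set.ncard_singleton, add_comm]

variable {ι}

theorem τ_not_mem_cotree {x : B.U} (hx : x ∈ T.cotree ι) : B.τ x ∉ T.cotree ι := fun h => by
  have h₁ := hx.2
  have h₂ := h.2
  rw [B.τ_involutive] at h₂
  omega

theorem mem_cotree_or (hι : Function.Injective ι) {x : B.U} (hx : ¬ T.IsTree x)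
    (hne : B.τ x ≠ x) : x ∈ T.cotree ι ∨ B.τ x ∈ T.cotree ι := by
  have h : ι x ≠ ι (B.τ x) := fun h => hne (Subtype.ext (hι h)).symm
  rcases lt_or_gt_of_ne h with h | h
  · exact .inl ⟨hx, h⟩
  · exact .inr ⟨fun h' => hx (T.isTree_τ.1 h'), by rwa [B.τ_involutive]⟩

theorem τ_not_mem_parents {x : B.U} (hx : x ∈ T.parents) : B.τ x ∉ T.parents := by
  rintro ⟨w, hw, h⟩
  obtain ⟨v, hv, h'⟩ := hx
  have h₁ := T.rank_τ_lt hv h'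
  have h₂ := T.rank_τ_lt hw h
  rw [B.τ_involutive] at h₂
  exact lt_asymm h₁ h₂

theorem isTree_of_mem_parents {x : B.U} (hx : x ∈ T.parents) : T.IsTree x := by
  obtain ⟨v, hv, h⟩ := hx
  exact ⟨v, hv, .inl h⟩

theorem τ_ne_of_mem {x : B.U} (hx : x ∈ T.parents ∪ T.cotree ι) : B.τ x ≠ x := by
  rcases hx with hx | hx
  · exact T.τ_ne_of_isTree (T.isTree_of_mem_parents hx)
  · intro h
    have := hx.2
    rw [h] at this
    exact lt_irrefl _ this

theorem τ_not_mem {x : B.U} (hx : x ∈ T.parents ∪ T.cotree ι) :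
    B.τ x ∉ T.parents ∪ T.cotree ι := by
  rintro (h | h)
  · rcases hx with hx | hx
    · exact T.τ_not_mem_parents hx h
    · exact hx.1 (T.isTree_τ.1 (T.isTree_of_mem_parents h))
  · rcases hx with hx | hx
    · exact h.1 (T.isTree_τ.2 (T.isTree_of_mem_parents hx))
    · exact T.τ_not_mem_cotree hx h

/-- The union contains exactly one half-edge of every edge: a tree edge is represented by its end of
larger rank, any other by its end with smaller `ι`. -/
theorem ncard_edges (hι : Function.Injective ι) :
    B.edges.ncard = (T.parents ∪ T.cotree ι).ncard := by
  symm
  refine Set.ncard_congr (fun x _ => {(x : E), (B.τ x : E)}) ?_ ?_ ?_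
  · exact fun x hx => ⟨x, T.τ_ne_of_mem hx, rfl⟩
  · intro x y hx hy h
    have hxy : (x : E) ∈ ({(y : E), (B.τ y : E)} : Set E) := h ▸ Set.mem_insert _ _
    rcases hxy with hxy | hxy
    · exact Subtype.ext hxy
    · obtain rfl : x = B.τ y := Subtype.ext hxy
      exact absurd hx (T.τ_not_mem hy)
  · rintro s ⟨x, hx, rfl⟩
    have hmem : x ∈ T.parents ∪ T.cotree ι ∨ B.τ x ∈ T.parents ∪ T.cotree ι := by
      by_cases ht : T.IsTree x
      · obtain ⟨v, hv, h | h⟩ := ht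
        · exact .inl (.inl ⟨v, hv, h⟩)
        · exact .inr (.inl ⟨v, hv, h⟩)
      · exact (T.mem_cotree_or hι ht hx).imp .inr .inr
    rcases hmem with h | h
    · exact ⟨x, h, rfl⟩
    · exact ⟨_, h, by rw [B.τ_involutive, Set.pair_comm]⟩

theorem ncard_edges_add_one [Finite E] (hι : Function.Injective ι) :
    B.edges.ncard + 1 = Nat.card B.Vertex + Nat.card (T.cotree ι) := by
  have hd : Disjoint T.parents (T.cotree ι) :=
    Set.disjoint_left.2 fun x hx hx' => hx'.1 (T.isTree_of_mem_parents hx)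
  rw [T.ncard_edges hι, Set.ncard_union_eq hd, ← T.ncard_parents, Nat.card_coe_set_eq]
  omega

theorem _root_.BrauerGSet.card_fixed :
    Nat.card {x : B.U // B.τ x = x} = B.doubleHalfEdges.ncard := by
  rw [← Nat.card_coe_set_eq]
  refine Nat.card_congr (Equiv.ofBijective (fun x => ⟨x.1, x.1, x.2, rfl⟩) ⟨?_, ?_⟩)
  · exact fun x y h => Subtype.ext (Subtype.ext (Subtype.mk.inj h))
  · rintro ⟨_, x, hx, rfl⟩
    exact ⟨⟨x, hx⟩, rfl⟩

end Count

/-! ### Comparison with the presented group. -/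

section Presentation

variable {E : Type*} [MulAction (Multiplicative ℤ) E] {B : BrauerGSet E} {e : E}
  (T : B.RootedTree e) {ι : E → ℕ} {n r l : ℕ} (d : Fin n → ℕ) (v : Fin n ≃ B.Vertex)
  (β : Fin r ≃ T.cotree ι) (κ : Fin l ≃ {x : B.U // B.τ x = x})

/-- The label of a vertex. -/
def presA (w : B.Vertex) : PresGroup d r l := PresentedGroup.of (.a (v.symm w))

open Classical in
/-- The label of the chosen half-edges outside the tree. -/
noncomputable def presB (x : B.U) : PresGroup d r l :=
  if h : x ∈ T.cotree ι then PresentedGroup.of (.b (β.symm ⟨x, h⟩)) else 1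

open Classical in
/-- The label of the letter `τ`. -/
noncomputable def presTau (x : B.U) : PresGroup d r l :=
  if h : B.τ x = x then PresentedGroup.of (.c (κ.symm ⟨x, h⟩))
  -- At most one of `x` and `B.τ x` is in the cotree, so this is a generator `b`, the inverse of
  -- one, or 1 on the tree.
  else presB T d β x * (presB T d β (B.τ x))⁻¹

theorem presGroup_relation {x : FreeGroup (PresGen n r l)} (h : PresRel d r l x) :
    (QuotientGroup.mk x : PresGroup d r l) = 1 :=
  PresentedGroup.one_of_mem h

theorem presGroup_a_eq (i j : Fin n) :
    (PresentedGroup.of (.a i) : PresGroup d r l) ^ d i = PresentedGroup.of (.a j) ^ d j :=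
  mul_inv_eq_one.1 (presGroup_relation d (.a_eq i j))

theorem presGroup_ab (i : Fin n) (j : Fin r) :
    (PresentedGroup.of (.a i) : PresGroup d r l) ^ d i * PresentedGroup.of (.b j) =
      PresentedGroup.of (.b j) * PresentedGroup.of (.a i) ^ d i :=
  mul_inv_eq_one.1 (presGroup_relation d (.ab i j))

theorem presGroup_ac (i : Fin n) (j : Fin l) :
    (PresentedGroup.of (.a i) : PresGroup d r l) ^ d i * PresentedGroup.of (.c j) =
      PresentedGroup.of (.c j) * PresentedGroup.of (.a i) ^ d i :=
  mul_inv_eq_one.1 (presGroup_relation d (.ac i j))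

theorem presGroup_c_sq (j : Fin l) : (PresentedGroup.of (.c j) : PresGroup d r l) ^ 2 = 1 :=
  presGroup_relation d (.c_sq j)

theorem isTauLabel_pres [Finite E] (hd : ∀ i, B.fDegree (v i) = d i) :
    T.IsTauLabel (presA d v) (presTau T d β κ) (fun w => d (v.symm w)) where
  degree w := B.vertexDegree_eq (by rw [← hd, v.apply_symm_apply])
  pow_eq _ _ := presGroup_a_eq d _ _
  pow_comm w x := by
    have hb : ∀ y, Commute (presA d v w ^ d (v.symm w)) (presB T d β (l := l) y) := by
      intro y
      rw [presB]
      split_ifs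
      · exact presGroup_ab d _ _
      · exact Commute.one_right _
    change Commute _ _
    rw [presTau]
    split_ifs
    · exact presGroup_ac d _ _
    · exact (hb _).mul_right (hb _).inv_right
  tau_tau x := by
    by_cases h : B.τ x = x
    · rw [h, presTau, dif_pos h, ← pow_two, presGroup_c_sq]
    · have h' : ¬ B.τ (B.τ x) = B.τ x := fun h' => h (B.τ_involutive.injective h')
      rw [presTau, presTau, dif_neg h, dif_neg h', B.τ_involutive]
      group
  tree x hx := by
    rw [presTau, dif_neg (T.τ_ne_of_isTree hx), presB, presB, dif_neg fun h => h.1 hx,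
      dif_neg fun h => h.1 (T.isTree_τ.2 hx), inv_one, mul_one]

/-- The loops that correspond to the generators. -/
noncomputable def genLoop [Finite E] : PresGen n r l → B.FundamentalGroup e
  | .a i => T.vertexLoop (v i)
  | .b i => T.tauLoop (β i).1
  | .c i => T.tauLoop (κ i).1

theorem lift_genLoop [Finite E] (hd : ∀ i, B.fDegree (v i) = d i)
    (x : FreeGroup (PresGen n r l)) (hx : x ∈ {x | PresRel d r l x}) :
    FreeGroup.lift (T.genLoop v β κ) x = 1 := by
  have hdeg : ∀ w, B.vertexDegree w = d (v.symm w) * B.vertexCard w :=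
    (T.isTauLabel_pres d v β κ hd).degree
  have heq : ∀ i j, T.vertexLoop (v i) ^ d i = T.vertexLoop (v j) ^ d j := fun i j => by
    simpa only [v.symm_apply_apply] using T.vertexLoop_pow_eq hdeg (v i) (v j)
  have hcomm : ∀ i u, T.vertexLoop (v i) ^ d i * u = u * T.vertexLoop (v i) ^ d i :=
    fun i u => by
      simpa only [v.symm_apply_apply] using T.vertexLoop_pow_comm hdeg (v i) u
  cases hx with
  | a_eq i j =>
    simp only [map_mul, map_inv, map_pow, FreeGroup.lift_apply_of]
    exact mul_inv_eq_one.2 (heq i j)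
  | ab i j =>
    simp only [map_mul, map_inv, map_pow, FreeGroup.lift_apply_of]
    exact mul_inv_eq_one.2 (hcomm i _)
  | ac i j =>
    simp only [map_mul, map_inv, map_pow, FreeGroup.lift_apply_of]
    exact mul_inv_eq_one.2 (hcomm i _)
  | c_sq j =>
    rw [map_pow, FreeGroup.lift_apply_of, genLoop, pow_two]
    have h := T.tauLoop_tauLoop (κ j).1
    rwa [(κ j).2] at h

/-- The homomorphism from the presented group to the fundamental group. -/
noncomputable def presHom [Finite E] (hd : ∀ i, B.fDegree (v i) = d i) :
    PresGroup d r l →* B.FundamentalGroup e :=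
  PresentedGroup.toGroup (T.lift_genLoop d v β κ hd)

theorem presHom_of [Finite E] (hd : ∀ i, B.fDegree (v i) = d i) (s : PresGen n r l) :
    T.presHom d v β κ hd (PresentedGroup.of s) = T.genLoop v β κ s :=
  PresentedGroup.toGroup.of _

theorem presHom_presTau [Finite E] (hι : Function.Injective ι)
    (hd : ∀ i, B.fDegree (v i) = d i) (x : B.U) :
    T.presHom d v β κ hd (presTau T d β κ x) = T.tauLoop x := by
  rw [presTau]
  split_ifs with h
  · rw [presHom_of, genLoop, κ.apply_symm_apply]
  · have hb : ∀ y ∈ T.cotree ι,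
        T.presHom d v β κ hd (presB T d β y * (presB T d β (B.τ y))⁻¹) = T.tauLoop y := by
      intro y hy
      rw [presB, presB, dif_pos hy, dif_neg (T.τ_not_mem_cotree hy), inv_one, mul_one,
        presHom_of, genLoop, β.apply_symm_apply]
    by_cases ht : T.IsTree x
    · rw [presB, presB, dif_neg fun h => h.1 ht, dif_neg fun h => h.1 (T.isTree_τ.2 ht), inv_one,
        mul_one, map_one, T.tauLoop_eq_one ht]
    · rcases T.mem_cotree_or hι ht h with hx | hx
      · exact hb x hx
      -- Here the chosen half-edge is `B.τ x`, so both the label and the loop of `x` are inverses of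
      -- those at `B.τ x`.
      · have h₁ := hb _ hx
        rw [B.τ_involutive, ← inv_inj, ← map_inv, mul_inv_rev, inv_inv] at h₁
        rw [h₁]
        exact inv_eq_of_mul_eq_one_right (T.tauLoop_tauLoop x)

theorem nonempty_mulEquiv_presGroup [Finite E] (T : B.RootedTree e) (hι : Function.Injective ι)
    (β : Fin r ≃ T.cotree ι) (κ : Fin l ≃ {x : B.U // B.τ x = x})
    (hd : ∀ i, B.fDegree (v i) = d i) :
    Nonempty (B.FundamentalGroup e ≃* PresGroup d r l) := by
  have hT := T.isTauLabel_pres d v β κ hd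
  refine ⟨MonoidHom.toMulEquiv (labelHom hT.isCompatible e) (T.presHom d v β κ hd) ?_ ?_⟩
  · ext u
    refine hT.map_labelHom _ (fun w => ?_) (T.presHom_presTau d v β κ hι hd) u
    rw [presA, presHom_of, genLoop, v.apply_symm_apply]
  · ext s
    change labelHom hT.isCompatible e (T.presHom d v β κ hd _) = PresentedGroup.of s
    rw [presHom_of]
    cases s with
    | a i => rw [genLoop, hT.labelHom_vertexLoop, presA, v.symm_apply_apply]
    | b i =>
      rw [genLoop, hT.labelHom_tauLoop, presTau, dif_neg (T.τ_ne_of_mem (.inr (β i).2)), presB,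
        presB, dif_pos (β i).2, dif_neg (T.τ_not_mem_cotree (β i).2), inv_one, mul_one,
        Subtype.coe_eta, β.symm_apply_apply]
    | c i =>
      rw [genLoop, hT.labelHom_tauLoop, presTau, dif_pos (κ i).2, Subtype.coe_eta,
        κ.symm_apply_apply]

end Presentation

end RootedTree
end BrauerGSet

theorem mainTheorem12 {E : Type*} [MulAction (Multiplicative ℤ) E] [Finite E]
    (B : BrauerGSet E) (hconn : B.Connected) (hint : B.IntegralFDegree)
    (n k l : ℕ) (v : Fin n ≃ B.Vertex)
    (d : Fin n → ℕ) (hd : ∀ i, B.fDegree (v i) = (d i : ℚ))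
    (hk : B.edges.ncard = k) (hl : B.doubleHalfEdges.ncard = l) (e : E) :
    n ≤ k + 1 ∧ Nonempty (B.FundamentalGroup e ≃* PresGroup d (k + 1 - n) l) := by
  obtain ⟨T⟩ := BrauerGSet.exists_rootedTree hconn e
  -- An arbitrary numbering of the half-edges, used only to orient the edges outside the tree.
  obtain ⟨ι, hι⟩ := Countable.exists_injective_nat E
  have hcount := T.ncard_edges_add_one hι
  have hn : Nat.card B.Vertex = n := by rw [← Nat.card_congr v, Nat.card_fin]
  rw [hk, hn] at hcount
  -- `hcount` now reads `k + 1 = n + |cotree|`, so `n ≤ k + 1` and the subtraction is not truncated.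
  exact ⟨by omega, T.nonempty_mulEquiv_presGroup d v hι
    (Finite.equivFinOfCardEq (by omega : Nat.card (T.cotree ι) = k + 1 - n)).symm
    (Finite.equivFinOfCardEq (B.card_fixed.trans hl)).symm hd⟩
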